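/- Let $\Bbbk$ be a field with $\operatorname{char}\Bbbk\neq 2$, let $V\neq 0$ be a finite-dimensional $\Bbbk$-vector space with ordered basis $x_1,\dots,x_n$ ($n\ge 1$), and let $\mu=(\mu_{ij})\in M(n,\Bbbk)$ be multiplicatively antisymmetric, i.e. $\mu_{ij}\mu_{ji}=\mu_{ii}=1$ for all $i,j$. Let $\phi:V\times V\to\Bbbk$ be a bilinear form that is $\mu$-symmetric relative to this basis, i.e. $\phi(x_i,x_j)=\mu_{ij}\phi(x_j,x_i)$ for all $i,j$. Let the skew Clifford algebra $\mathrm{sCl}(V,\mu,\phi)$ be the quotient of the tensor algebra $T(V)$ by the two-sided ideal generated by the elements $x_i\otimes x_j+\mu_{ij}\,x_j\otimes x_i-2\phi(x_i,x_j)\cdot 1$ for all $i,j$. If $\mathrm{sCl}(V,\mu,\phi)\neq\{0\}$, then it is finite-dimensional over $\Bbbk$ and $\dim_{\Bbbk}\mathrm{sCl}(V,\mu,\phi)=2^j$ for some integer $j$ with $1\le j\le \dim_{\Bbbk} V$. -/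

import Mathlib

/-- `μ ∈ M(n, K)` is multiplicatively antisymmetric: `μ i j * μ j i = μ i i = 1` for all `i, j`. -/
def IsMultAntisymm {K : Type*} [Field K] {n : ℕ} (μ : Matrix (Fin n) (Fin n) K) : Prop :=
  ∀ i j, μ i j * μ j i = 1 ∧ μ i i = 1

/-- The bilinear form `φ` is `μ`-symmetric relative to the ordered basis `x`. -/
def IsMuSymm {K V : Type*} [Field K] [AddCommGroup V] [Module K V] {n : ℕ}
    (x : Module.Basis (Fin n) K V) (μ : Matrix (Fin n) (Fin n) K)
    (φ : LinearMap.BilinForm K V) : Prop :=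
  ∀ i j, φ (x i) (x j) = μ i j * φ (x j) (x i)

/-- The defining relations of the skew Clifford algebra: each generator
`xᵢ ⊗ xⱼ + μᵢⱼ xⱼ ⊗ xᵢ - 2 φ(xᵢ, xⱼ) · 1` of the ideal is identified with `0`. -/
inductive SkewCliffordRel {K V : Type*} [Field K] [AddCommGroup V] [Module K V] {n : ℕ}
    (x : Module.Basis (Fin n) K V) (μ : Matrix (Fin n) (Fin n) K)
    (φ : LinearMap.BilinForm K V) : TensorAlgebra K V → TensorAlgebra K V → Prop
  | of (i j : Fin n) : SkewCliffordRel x μ φ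
      (TensorAlgebra.ι K (x i) * TensorAlgebra.ι K (x j)
        + μ i j • (TensorAlgebra.ι K (x j) * TensorAlgebra.ι K (x i))
        - algebraMap K (TensorAlgebra K V) (2 * φ (x i) (x j))) 0

/-- The skew Clifford algebra `sCl(V, μ, φ)`, with respect to the ordered basis `x` of `V`:
the quotient of the tensor algebra `T(V)` by the two-sided ideal generated by the elements
`xᵢ ⊗ xⱼ + μᵢⱼ xⱼ ⊗ xᵢ - 2 φ(xᵢ, xⱼ) · 1`. -/
def SkewCliffordAlgebra {K V : Type*} [Field K] [AddCommGroup V] [Module K V] {n : ℕ}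
    (x : Module.Basis (Fin n) K V) (μ : Matrix (Fin n) (Fin n) K)
    (φ : LinearMap.BilinForm K V) :=
  RingQuot (SkewCliffordRel x μ φ)

namespace SkewCliffordAlgebra

instance instRing {K V : Type*} [Field K] [AddCommGroup V] [Module K V] {n : ℕ}
    (x : Module.Basis (Fin n) K V) (μ : Matrix (Fin n) (Fin n) K)
    (φ : LinearMap.BilinForm K V) : Ring (SkewCliffordAlgebra x μ φ) :=
  RingQuot.instRing _

instance instAlgebra {K V : Type*} [Field K] [AddCommGroup V] [Module K V] {n : ℕ}
    (x : Module.Basis (Fin n) K V) (μ : Matrix (Fin n) (Fin n) K)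
    (φ : LinearMap.BilinForm K V) : Algebra K (SkewCliffordAlgebra x μ φ) :=
  RingQuot.instAlgebra _

end SkewCliffordAlgebra

/-! The algebra is presented by generators `x_i` with `x_i x_j + m_ij x_j x_i = d_ij`, where `d =
2φ`. Call the constants consistent if `d_jk ≠ 0` forces `m_ij m_ik = 1`: moving the scalar `d_jk`
past `x_i` must cost nothing, while moving `x_j x_k` costs this factor.

For consistent constants the algebra has dimension `2 ^ n` (`SkewAlg.finite_and_finrank`): it is
free of rank two, with basis `1, x_0`, over the algebra `B` on the other generators. It is an Ore
extension of `B` cut down by `x_0² = d_00 / 2`.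

If elements satisfying the relations are pairwise linearly independent, comparing the two
reorderings of `x_i x_j x_k` shows that the constants are consistent
(`SatisfiesSkewRel.consistent`).

In general, some generators vanish or become proportional in the quotient. Keeping one
representative of each class of nonzero proportional generators gives `N ≤ n` of them, and they
present the same algebra (`exists_algEquiv_of_representatives`). Hence the dimension is `2 ^ N`.
Finally `N ≥ 1`, because a nontrivial algebra has a nonzero generator. -/

/-- The elements `a i` of an algebra satisfy the relations
`a i * a j + m i j • (a j * a i) = d i j`. -/
abbrev SatisfiesSkewRel {K A ι : Type*} [Field K] [Ring A] [Algebra K A]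
    (m d : ι → ι → K) (a : ι → A) : Prop :=
  ∀ i j, a i * a j + m i j • (a j * a i) = algebraMap K A (d i j)

/-- The relations between free generators indexed by `ι` which present `SkewAlg m d`. -/
inductive SkewAlgRel {K ι : Type*} [Field K] (m d : ι → ι → K) :
    FreeAlgebra K ι → FreeAlgebra K ι → Prop
  | of (i j : ι) : SkewAlgRel m d
      (FreeAlgebra.ι K i * FreeAlgebra.ι K j + m i j • (FreeAlgebra.ι K j * FreeAlgebra.ι K i))
      (algebraMap K (FreeAlgebra K ι) (d i j))

/-- The universal algebra on generators satisfying `SatisfiesSkewRel m d`. -/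
def SkewAlg {K ι : Type*} [Field K] (m d : ι → ι → K) := RingQuot (SkewAlgRel m d)

instance SkewAlg.instRing {K ι : Type*} [Field K] (m d : ι → ι → K) : Ring (SkewAlg m d) :=
  RingQuot.instRing _

instance SkewAlg.instAlgebra {K ι : Type*} [Field K] (m d : ι → ι → K) :
    Algebra K (SkewAlg m d) :=
  RingQuot.instAlgebra _

/-- Consistency of the structure constants: multiplicative antisymmetry of `m`, `m`-symmetry of
`d`, and centrality of the degree of `d j k` whenever it is nonzero. -/
structure SkewConsistent {K ι : Type*} [Field K] (m d : ι → ι → K) : Prop where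
  mul_swap : ∀ i j, m i j * m j i = 1
  diag : ∀ i, m i i = 1
  symm : ∀ i j, d i j = m i j * d j i
  central : ∀ i j k, d j k ≠ 0 → m i j * m i k = 1

namespace SkewAlg

/-! ### Presentation and universal property. -/

section Basic

variable {K ι : Type*} [Field K] (m d : ι → ι → K)

/-- The quotient map from the free algebra. -/
def mk : FreeAlgebra K ι →ₐ[K] SkewAlg m d := RingQuot.mkAlgHom K (SkewAlgRel m d)

theorem mk_surjective : Function.Surjective (mk m d) :=
  RingQuot.mkAlgHom_surjective K (SkewAlgRel m d)

/-- The generators of `SkewAlg m d`. -/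
def gen (i : ι) : SkewAlg m d := mk m d (FreeAlgebra.ι K i)

theorem gen_satisfies : SatisfiesSkewRel m d (gen m d) := by
  intro i j
  have h : mk m d _ = mk m d _ := RingQuot.mkAlgHom_rel K (SkewAlgRel.of (m := m) (d := d) i j)
  simpa [gen] using h

variable {m d}

/-- The universal property of `SkewAlg m d`. -/
def lift {A : Type*} [Ring A] [Algebra K A] (a : ι → A) (ha : SatisfiesSkewRel m d a) :
    SkewAlg m d →ₐ[K] A :=
  RingQuot.liftAlgHom K ⟨FreeAlgebra.lift K a, by
    rintro _ _ ⟨i, j⟩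
    simpa using ha i j⟩

@[simp]
theorem lift_gen {A : Type*} [Ring A] [Algebra K A] (a : ι → A) (ha : SatisfiesSkewRel m d a)
    (i : ι) : lift a ha (gen m d i) = a i :=
  (RingQuot.liftAlgHom_mkAlgHom_apply K (FreeAlgebra.lift K a) _ _).trans (by simp)

theorem induction {C : SkewAlg m d → Prop} (hC : ∀ r : K, C (algebraMap K _ r))
    (hgen : ∀ i, C (gen m d i)) (hmul : ∀ a b, C a → C b → C (a * b))
    (hadd : ∀ a b, C a → C b → C (a + b)) (a : SkewAlg m d) : C a := by
  obtain ⟨a, rfl⟩ := mk_surjective m d a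
  induction a using FreeAlgebra.induction with
  | grade0 r => simpa using hC r
  | grade1 i => exact hgen i
  | mul a b ha hb => simpa using hmul _ _ ha hb
  | add a b ha hb => simpa using hadd _ _ ha hb

theorem hom_ext {A : Type*} [Ring A] [Algebra K A] {f g : SkewAlg m d →ₐ[K] A}
    (h : ∀ i, f (gen m d i) = g (gen m d i)) : f = g := by
  refine AlgHom.ext fun a => ?_
  induction a using induction with
  | hC r => simp
  | hgen i => exact h i
  | hmul a b ha hb => simp [ha, hb]
  | hadd a b ha hb => simp [ha, hb]

end Basic

attribute [irreducible] SkewAlg.instRing SkewAlg.instAlgebra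

/-! ### Consistent constants: adjoining one generator by an Ore extension. -/

section Extension

variable {K : Type*} [Field K] {n : ℕ} {m d : Fin (n + 1) → Fin (n + 1) → K}

/-- The restriction of structure constants to all indices but the first. -/
abbrev tail (m : Fin (n + 1) → Fin (n + 1) → K) : Fin n → Fin n → K :=
  fun i j => m i.succ j.succ

theorem _root_.SkewConsistent.tail (h : SkewConsistent m d) :
    SkewConsistent (SkewAlg.tail m) (SkewAlg.tail d) :=
  ⟨fun _ _ => h.mul_swap _ _, fun _ => h.diag _, fun _ _ => h.symm _ _,
    fun _ _ _ => h.central _ _ _⟩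

theorem _root_.SkewConsistent.mul_eq (h : SkewConsistent m d) (i j k : Fin (n + 1)) :
    m i j * m i k * d j k = d j k := by
  by_cases hd : d j k = 0
  · simp [hd]
  · rw [h.central i j k hd, one_mul]

theorem _root_.SkewConsistent.mul_eq' (h : SkewConsistent m d) (i j k : Fin (n + 1)) :
    m j i * m k i * d j k = d j k := by
  linear_combination (-m j i * m k i) * h.mul_eq i j k
    + d j k * m i k * m k i * h.mul_swap i j + d j k * h.mul_swap i k

theorem _root_.SkewConsistent.mul_left_eq (h : SkewConsistent m d) (i j k : Fin (n + 1)) :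
    m j i * d j k = m i k * d j k := by
  linear_combination (-m j i) * h.mul_eq i j k + m i k * d j k * h.mul_swap i j

/-- The twist of the Ore extension by the first generator. -/
def twist (h : SkewConsistent m d) :
    SkewAlg (tail m) (tail d) →ₐ[K] SkewAlg (tail m) (tail d) :=
  lift (fun i => (-m 0 i.succ) • gen (tail m) (tail d) i) fun i j => by
    have h1 := gen_satisfies (tail m) (tail d) i j
    have h2 := h.mul_eq 0 i.succ j.succ
    calc _ = (m 0 i.succ * m 0 j.succ) • (gen (tail m) (tail d) i * gen (tail m) (tail d) j
          + tail m i j • (gen (tail m) (tail d) j * gen (tail m) (tail d) i)) := by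
          simp only [smul_mul_smul_comm]; module
      _ = _ := by rw [h1, Algebra.smul_def, ← map_mul, h2]

/-- The twist together with its skew derivation, as a triangular matrix. -/
def triangular (h : SkewConsistent m d) :
    SkewAlg (tail m) (tail d) →ₐ[K] Matrix (Fin 2) (Fin 2) (SkewAlg (tail m) (tail d)) :=
  lift (fun i => !![(-m 0 i.succ) • gen (tail m) (tail d) i, algebraMap K _ (d 0 i.succ);
      0, gen (tail m) (tail d) i]) fun i j => by
    have h1 := gen_satisfies (tail m) (tail d) i j
    have h0 : -m 0 i.succ • gen (tail m) (tail d) i * -m 0 j.succ • gen (tail m) (tail d) j +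
        m i.succ j.succ • (-m 0 j.succ • gen (tail m) (tail d) j *
          -m 0 i.succ • gen (tail m) (tail d) i) = algebraMap K (SkewAlg (tail m) (tail d)) (tail d i j) := by
      simpa only [map_add, map_mul, map_smul, twist, lift_gen, AlgHom.commutes] using
        congrArg (twist h) h1
    have e1 := h.mul_eq' j.succ 0 i.succ
    have e2 := h.mul_left_eq i.succ 0 j.succ
    -- This is the upper right entry of the relation; consistency kills the coefficient of each
    -- generator separately.
    have h2 : ((-m 0 i.succ * d 0 j.succ + m i.succ j.succ * d 0 j.succ) •
        gen (tail m) (tail d) i + (d 0 i.succ - m i.succ j.succ * m 0 j.succ * d 0 i.succ) •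
        gen (tail m) (tail d) j) = 0 := by
      rw [show -m 0 i.succ * d 0 j.succ + m i.succ j.succ * d 0 j.succ = 0 by
        linear_combination -e2, show d 0 i.succ - m i.succ j.succ * m 0 j.succ * d 0 i.succ = 0 by
        linear_combination -e1, zero_smul, zero_smul, add_zero]
    ext a b
    fin_cases a <;> fin_cases b
    · simpa [Matrix.mul_apply, Matrix.algebraMap_matrix_apply, smul_smul, mul_comm,
        mul_left_comm] using h0
    · simp [Matrix.algebraMap_matrix_apply, Algebra.algebraMap_eq_smul_one]
      rw [← h2]
      module
    · simp [Matrix.algebraMap_matrix_apply]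
    · simpa [Matrix.mul_apply, Matrix.algebraMap_matrix_apply] using h1

theorem triangular_apply (h : SkewConsistent m d) (b : SkewAlg (tail m) (tail d)) :
    triangular h b = !![twist h b, triangular h b 0 1; 0, b] := by
  induction b using induction with
  | hC r =>
    ext i j
    fin_cases i <;> fin_cases j <;> simp [Matrix.algebraMap_matrix_apply]
  | hgen i => simp [triangular, twist]
  | hmul a b ha hb =>
    rw [map_mul, ha, hb]
    ext i j
    fin_cases i <;> fin_cases j <;> simp [Matrix.mul_apply]
  | hadd a b ha hb =>
    rw [map_add, ha, hb]
    ext i j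
    fin_cases i <;> fin_cases j <;> simp

/-- The skew derivation of the Ore extension by the first generator. -/
def derivation (h : SkewConsistent m d) :
    SkewAlg (tail m) (tail d) →ₗ[K] SkewAlg (tail m) (tail d) where
  toFun b := triangular h b 0 1
  map_add' a b := by simp
  map_smul' r a := by simp

theorem derivation_gen (h : SkewConsistent m d) (i : Fin n) :
    derivation h (gen _ _ i) = algebraMap K _ (d 0 i.succ) := by
  simp [derivation, triangular]

theorem twist_gen (h : SkewConsistent m d) (i : Fin n) :
    twist h (gen _ _ i) = (-m 0 i.succ) • gen _ _ i := by
  simp [twist]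

theorem derivation_algebraMap (h : SkewConsistent m d) (r : K) :
    derivation h (algebraMap K _ r) = 0 := by
  simp [derivation, Matrix.algebraMap_matrix_apply]

theorem derivation_mul (h : SkewConsistent m d) (a b : SkewAlg (tail m) (tail d)) :
    derivation h (a * b) = twist h a * derivation h b + derivation h a * b := by
  change triangular h (a * b) 0 1 = twist h a * triangular h b 0 1 + triangular h a 0 1 * b
  rw [map_mul, triangular_apply h a, triangular_apply h b]
  simp [Matrix.mul_apply]

theorem twist_derivation (h : SkewConsistent m d) (a : SkewAlg (tail m) (tail d)) :
    twist h (derivation h a) + derivation h (twist h a) = 0 := by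
  induction a using induction with
  | hC r => simp [derivation_algebraMap]
  | hgen i =>
    have := h.mul_eq 0 0 i.succ
    rw [h.diag, one_mul] at this
    rw [derivation_gen, twist_gen, map_smul, derivation_gen, AlgHom.commutes, Algebra.smul_def,
      ← map_mul, ← map_add, neg_mul, this, add_neg_cancel, map_zero]
  | hmul a b ha hb =>
    have ha' := eq_neg_of_add_eq_zero_left ha
    have hb' := eq_neg_of_add_eq_zero_left hb
    simp only [derivation_mul, map_mul, map_add, ha', hb', mul_neg, neg_mul]
    abel
  | hadd a b ha hb =>
    rw [map_add, map_add, map_add, map_add, add_add_add_comm, ha, hb, add_zero]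

theorem derivation_derivation (h : SkewConsistent m d) (a : SkewAlg (tail m) (tail d)) :
    derivation h (derivation h a) = 0 := by
  induction a using induction with
  | hC r => simp [derivation_algebraMap]
  | hgen i => rw [derivation_gen, derivation_algebraMap]
  | hmul a b ha hb =>
    have ha' := eq_neg_of_add_eq_zero_left (twist_derivation h a)
    simp only [derivation_mul, map_add, ha', ha, hb, mul_zero, zero_mul, neg_mul]
    abel
  | hadd a b ha hb => rw [map_add, map_add, ha, hb, add_zero]

/-- The factor `d 0 0` is needed: consistency gives `m 0 i ^ 2 = 1` only when `d 0 0 ≠ 0`. -/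
theorem twist_twist (h : SkewConsistent m d) (a : SkewAlg (tail m) (tail d)) :
    d 0 0 • twist h (twist h a) = d 0 0 • a := by
  by_cases h0 : d 0 0 = 0
  · simp [h0]
  congr 1
  refine DFunLike.congr_fun (hom_ext (f := (twist h).comp (twist h)) (g := .id K _)
    fun i => ?_) a
  have hc : m 0 i.succ * m 0 i.succ = 1 := by
    have h1 := h.central i.succ 0 0 h0
    have h2 := h.mul_swap 0 i.succ
    linear_combination (-m 0 i.succ * m 0 i.succ) * h1 + (m 0 i.succ * m i.succ 0 + 1) * h2
  simp [twist_gen, smul_smul, hc]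

/-- The action of the first generator on two copies of the algebra on the other generators. -/
def firstAction (h : SkewConsistent m d) :
    Module.End K (SkewAlg (tail m) (tail d) × SkewAlg (tail m) (tail d)) :=
  LinearMap.prod
    (derivation h ∘ₗ LinearMap.fst K _ _ + (d 0 0 / 2) • (twist h).toLinearMap ∘ₗ
      LinearMap.snd K _ _)
    ((twist h).toLinearMap ∘ₗ LinearMap.fst K _ _ + derivation h ∘ₗ LinearMap.snd K _ _)

/-- With `(a, c)` read as `a + c x_0`, this is left multiplication by `x_0`, computed from `x_0 b =
τ(b) x_0 + δ(b)` and `x_0² = d_00 / 2`, where `τ` is `twist` and `δ` is `derivation`. -/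
theorem firstAction_apply (h : SkewConsistent m d) (a c : SkewAlg (tail m) (tail d)) :
    firstAction h (a, c) =
      (derivation h a + (d 0 0 / 2) • twist h c, twist h a + derivation h c) := rfl

/-- Expanding the square leaves only `τδ + δτ = 0`, `δ² = 0` and `d_00 τ² = d_00`. -/
theorem firstAction_firstAction (h : SkewConsistent m d)
    (v : SkewAlg (tail m) (tail d) × SkewAlg (tail m) (tail d)) :
    firstAction h (firstAction h v) = (d 0 0 / 2) • v := by
  obtain ⟨a, c⟩ := v
  have ht (b : SkewAlg (tail m) (tail d)) : (d 0 0 / 2) • twist h (twist h b) = (d 0 0 / 2) • b := by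
    rw [div_eq_inv_mul, mul_smul, twist_twist, ← mul_smul]
  have ha := eq_neg_of_add_eq_zero_left (twist_derivation h a)
  have hc := eq_neg_of_add_eq_zero_left (twist_derivation h c)
  simp only [firstAction_apply, map_add, map_smul, derivation_derivation, ha, hc, smul_add, ht,
    Prod.smul_mk]
  ext <;> simp

/-- The action of all generators on two copies of the algebra on all generators but the first. -/
def action (h2 : (2 : K) ≠ 0) (h : SkewConsistent m d) :
    SkewAlg m d →ₐ[K]
      Module.End K (SkewAlg (tail m) (tail d) × SkewAlg (tail m) (tail d)) :=
  lift (Fin.cases (firstAction h) fun i => Algebra.lsmul K K _ (gen (tail m) (tail d) i)) <| by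
    have key (i : Fin n) (v : SkewAlg (tail m) (tail d) × SkewAlg (tail m) (tail d)) :
        firstAction h (gen (tail m) (tail d) i • v)
          + m 0 i.succ • gen (tail m) (tail d) i • firstAction h v = d 0 i.succ • v := by
      obtain ⟨a, c⟩ := v
      ext
      · simp [firstAction_apply, derivation_mul, derivation_gen, twist_gen,
          Algebra.algebraMap_eq_smul_one, mul_add]
        module
      · simp [firstAction_apply, derivation_mul, derivation_gen, twist_gen,
          Algebra.algebraMap_eq_smul_one, mul_add]
        module
    intro i j
    refine LinearMap.ext fun v => ?_
    cases i using Fin.cases with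
    | zero =>
      cases j using Fin.cases with
      | zero =>
        simp only [Fin.cases_zero, h.diag, one_smul, LinearMap.add_apply, Module.End.mul_apply,
          firstAction_firstAction, Module.algebraMap_end_apply]
        have : NeZero (2 : K) := ⟨h2⟩
        rw [← add_smul, add_halves]
      | succ j => simpa using key j v
    | succ i =>
      cases j using Fin.cases with
      | zero =>
        have := congrArg (m i.succ 0 • ·) (key i v)
        simp only [smul_add, smul_smul, ← h.symm, h.mul_swap, one_smul] at this
        simpa [add_comm] using this
      | succ j =>
        have := congrArg (· • v) (gen_satisfies (tail m) (tail d) i j)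
        simpa [add_smul, mul_smul] using this

/-- The algebra on all generators but the first maps to the whole algebra. -/
def tailHom (m d : Fin (n + 1) → Fin (n + 1) → K) : SkewAlg (tail m) (tail d) →ₐ[K] SkewAlg m d :=
  lift (fun i => gen m d i.succ) fun _ _ => gen_satisfies m d _ _

theorem gen_zero_mul_tailHom (h : SkewConsistent m d) (a : SkewAlg (tail m) (tail d)) :
    gen m d 0 * tailHom m d a =
      tailHom m d (twist h a) * gen m d 0 + tailHom m d (derivation h a) := by
  induction a using induction with
  | hC r => simp [derivation_algebraMap, Algebra.commutes]
  | hgen i =>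
    have := gen_satisfies m d 0 i.succ
    simp only [tailHom, lift_gen, twist_gen, derivation_gen, map_smul, AlgHom.commutes]
    rw [← this]
    simp
  | hmul a b ha hb =>
    rw [map_mul, ← mul_assoc, ha, add_mul, mul_assoc, hb, derivation_mul]
    simp only [map_mul, map_add]
    noncomm_ring
  | hadd a b ha hb =>
    simp only [map_add, mul_add, ha, hb]
    noncomm_ring

theorem gen_mul_gen (h2 : (2 : K) ≠ 0) {ι A : Type*} [Ring A] [Algebra K A] {m d : ι → ι → K}
    {a : ι → A} (ha : SatisfiesSkewRel m d a) {i : ι} (hi : m i i = 1) :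
    a i * a i = algebraMap K A (d i i / 2) := by
  have h := ha i i
  rw [hi, one_smul, ← two_smul K] at h
  have := congrArg ((2 : K)⁻¹ • ·) h
  simp only [smul_smul, inv_mul_cancel₀ h2, one_smul] at this
  rw [this, Algebra.smul_def, ← map_mul, div_eq_inv_mul]

/-- The algebra is free of rank two over the subalgebra on all generators but the first. -/
def prodEquiv (h2 : (2 : K) ≠ 0) (h : SkewConsistent m d) :
    (SkewAlg (tail m) (tail d) × SkewAlg (tail m) (tail d)) ≃ₗ[K] SkewAlg m d :=
  have act (b : SkewAlg (tail m) (tail d))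
      (v : SkewAlg (tail m) (tail d) × SkewAlg (tail m) (tail d)) :
      action h2 h (tailHom m d b) v = b • v := by
    have : (action h2 h).comp (tailHom m d) = Algebra.lsmul K K _ :=
      hom_ext fun i => by simp [action, tailHom]
    exact congr($this b v)
  have act0 (v : SkewAlg (tail m) (tail d) × SkewAlg (tail m) (tail d)) :
      action h2 h (gen m d 0) v = firstAction h v := by simp [action]
  let f : (SkewAlg (tail m) (tail d) × SkewAlg (tail m) (tail d)) →ₗ[K] SkewAlg m d :=
    LinearMap.coprod (tailHom m d).toLinearMap
      (LinearMap.mulRight K (gen m d 0) ∘ₗ (tailHom m d).toLinearMap)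
  -- Since `f` intertwines the action with left multiplication and `f (1, 0) = 1`, evaluating the
  -- action at `(1, 0)` inverts `f`.
  have hf (p : SkewAlg m d) (v : SkewAlg (tail m) (tail d) × SkewAlg (tail m) (tail d)) :
      f (action h2 h p v) = p * f v := by
    induction p using induction generalizing v with
    | hC r => rw [AlgHom.commutes, Module.algebraMap_end_apply, map_smul, Algebra.smul_def]
    | hgen i =>
      obtain ⟨a, c⟩ := v
      cases i using Fin.cases with
      | zero =>
        have hx := gen_mul_gen h2 (gen_satisfies m d) (h.diag 0)
        rw [act0, firstAction_apply]
        simp only [f, LinearMap.coprod_apply, AlgHom.toLinearMap_apply, LinearMap.comp_apply,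
          LinearMap.mulRight_apply, map_add, map_smul, mul_add, ← mul_assoc,
          gen_zero_mul_tailHom h, add_mul]
        rw [mul_assoc (tailHom m d (twist h c)), hx, ← Algebra.commutes, ← Algebra.smul_def]
        abel
      | succ i =>
        have : gen m d i.succ = tailHom m d (gen _ _ i) := by simp [tailHom]
        rw [this, act]
        simp [f, mul_add, mul_assoc]
    | hmul a b ha hb => rw [map_mul, Module.End.mul_apply, ha, hb, mul_assoc]
    | hadd a b ha hb => rw [map_add, LinearMap.add_apply, map_add, ha, hb, add_mul]
  { f with
    invFun := fun p => action h2 h p (1, 0)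
    left_inv := fun v => by
      obtain ⟨a, c⟩ := v
      have h1 : derivation h 1 = 0 := by simpa using derivation_algebraMap h 1
      simp [f, act, act0, firstAction_apply, h1]
    right_inv := fun p => by
      have := hf p (1, 0)
      simpa [f] using this }

end Extension

theorem algebraMap_bijective_of_isEmpty {K ι : Type*} [Field K] [IsEmpty ι] (m d : ι → ι → K) :
    Function.Bijective (algebraMap K (SkewAlg m d)) := by
  let f : SkewAlg m d →ₐ[K] K := lift isEmptyElim fun i => isEmptyElim i
  have hf : (Algebra.ofId K (SkewAlg m d)).comp f = .id K _ := hom_ext fun i => isEmptyElim i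
  exact ⟨fun a b hab => by simpa using congrArg f hab, fun a => ⟨f a, congr($hf a)⟩⟩

/-- A consistent family of structure constants gives an algebra of the maximal dimension. -/
theorem finite_and_finrank {K : Type*} [Field K] (h2 : (2 : K) ≠ 0) {n : ℕ}
    {m d : Fin n → Fin n → K} (h : SkewConsistent m d) :
    Module.Finite K (SkewAlg m d) ∧ Module.finrank K (SkewAlg m d) = 2 ^ n := by
  induction n with
  | zero =>
    let e : K ≃ₗ[K] SkewAlg m d :=
      LinearEquiv.ofBijective (Algebra.linearMap K _) (algebraMap_bijective_of_isEmpty m d)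
    exact ⟨Module.Finite.equiv e, by rw [← e.finrank_eq]; simp⟩
  | succ n ih =>
    obtain ⟨h3, h4⟩ := ih h.tail
    refine ⟨Module.Finite.equiv (prodEquiv h2 h), ?_⟩
    rw [← (prodEquiv h2 h).finrank_eq, Module.finrank_prod, h4, pow_succ, mul_two]

end SkewAlg

/-! ### Overlap relations and consistency from pairwise independence. -/

namespace SatisfiesSkewRel

section Relations

variable {K A ι : Type*} [Field K] [Ring A] [Algebra K A] {m d : ι → ι → K} {a : ι → A}

theorem mul_eq (ha : SatisfiesSkewRel m d a) (i j : ι) :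
    a i * a j = d i j • 1 - m i j • (a j * a i) := by
  rw [← Algebra.algebraMap_eq_smul_one, ← ha i j, add_sub_cancel_right]

/-- The linear relation obtained by reordering `a i * a j * a k` in two ways. -/
theorem overlap (ha : SatisfiesSkewRel m d a) (i j k : ι) :
    (d j k * (m i j * m i k - 1)) • a i + (d i k * (m j k - m i j)) • a j
      + (d i j * (1 - m j k * m i k)) • a k = 0 := by
  have h1 : a i * a j * a k = d i j • a k - m i j • (d i k • a j
      - m i k • (d j k • a i - m j k • (a k * a j * a i))) := by
    rw [ha.mul_eq i j, sub_mul, smul_mul_assoc, smul_mul_assoc, one_mul, mul_assoc (a j),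
      ha.mul_eq i k, mul_sub, mul_smul_comm, mul_smul_comm, mul_one, ← mul_assoc (a j),
      ha.mul_eq j k, sub_mul, smul_mul_assoc, smul_mul_assoc, one_mul]
  have h2 : a i * (a j * a k) = d j k • a i - m j k • (d i k • a j
      - m i k • (d i j • a k - m i j • (a k * a j * a i))) := by
    rw [ha.mul_eq j k, mul_sub, mul_smul_comm, mul_smul_comm, mul_one, ← mul_assoc (a i),
      ha.mul_eq i k, sub_mul, smul_mul_assoc, smul_mul_assoc, one_mul, mul_assoc (a k),
      ha.mul_eq i j, mul_sub, mul_smul_comm, mul_smul_comm, mul_one, mul_assoc (a k)]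
  have h3 := sub_eq_zero.2 (h1.symm.trans ((mul_assoc _ _ _).trans h2))
  rw [← h3]
  module

end Relations

end SatisfiesSkewRel

/-- The values of a family at distinct indices are linearly independent. -/
def PairwiseLinearIndependent (K : Type*) {A ι : Type*} [Field K] [AddCommGroup A] [Module K A]
    (a : ι → A) : Prop :=
  ∀ i j, i ≠ j → ∀ s t : K, s • a i + t • a j = 0 → s = 0 ∧ t = 0

section Consistency

variable {K A ι : Type*} [Field K] [Ring A] [Algebra K A] {m d : ι → ι → K} {a : ι → A}

theorem SatisfiesSkewRel.consistent (h2 : (2 : K) ≠ 0) (ha : SatisfiesSkewRel m d a)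
    (hm : ∀ i j, m i j * m j i = 1) (hm' : ∀ i, m i i = 1) (hd : ∀ i j, d i j = m i j * d j i)
    (hp : PairwiseLinearIndependent K a) : SkewConsistent m d := by
  -- The overlap of `i, i, k` has only two distinct generators, so independence applies; the
  -- coefficient of `a i` doubles, and 2 is cancelled.
  have diag (i k : ι) (hik : i ≠ k) :
      d i k * (m i k - 1) = 0 ∧ d i i * (1 - m i k * m i k) = 0 := by
    have h := ha.overlap i i k
    rw [← add_smul, hm', one_mul, ← two_mul] at h
    obtain ⟨h3, h4⟩ := hp i k hik _ _ h
    exact ⟨(mul_eq_zero.1 h3).resolve_left h2, h4⟩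
  have off (i k : ι) (h : d i k ≠ 0) : m i k = 1 := by
    by_cases hik : i = k
    · rw [hik, hm']
    · exact sub_eq_zero.1 ((mul_eq_zero.1 (diag i k hik).1).resolve_left h)
  have swap (i j : ι) (h : d i j ≠ 0) : d j i ≠ 0 := fun h' => h (by rw [hd, h', mul_zero])
  refine ⟨hm, hm', hd, fun i j k hjk => ?_⟩
  by_cases hij : i = j
  · subst hij
    rw [hm', one_mul, off _ _ hjk]
  by_cases hik : i = k
  · subst hik
    rw [hm', mul_one, off _ _ (swap _ _ hjk)]
  by_cases hjk' : j = k
  · subst hjk'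
    have h := sub_eq_zero.1 ((mul_eq_zero.1 (diag j i (Ne.symm hij)).2).resolve_left hjk)
    linear_combination (m i j * m i j) * h + (m i j * m j i + 1) * hm i j
  have h := ha.overlap i j k
  rw [off j k hjk] at h
  suffices d j k * (m i j * m i k - 1) = 0 from
    sub_eq_zero.1 ((mul_eq_zero.1 this).resolve_left hjk)
  -- Only pairs are known to be independent, so one of the three terms must drop out: the middle one
  -- if `d i k = 0`, otherwise the last, as then `m i k = m j k = 1`.
  by_cases h0 : d i k = 0
  · rw [h0, zero_mul, zero_smul, add_zero] at h
    exact (hp i k hik _ _ h).1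
  · rw [off i k h0, mul_one (1 : K), sub_self, mul_zero, zero_smul, add_zero] at h
    rw [off i k h0]
    exact (hp i j hij _ _ h).1

/-- A scalar product of independent generators vanishes. -/
theorem SatisfiesSkewRel.mul_eq_zero_of_eq_algebraMap (h2 : (2 : K) ≠ 0)
    (ha : SatisfiesSkewRel m d a) {s t : ι} (hs : m s s = 1)
    (hst : ∀ u v : K, u • a s + v • a t = 0 → u = 0 ∧ v = 0) {r : K}
    (h : a s * a t = algebraMap K A r) : a s * a t = 0 := by
  -- Evaluating `a s * a s * a t` both ways gives `r • a s = (d s s / 2) • a t`, so `r = 0`.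
  have h1 : a s * (a s * a t) = (d s s / 2) • a t := by
    rw [← mul_assoc, SkewAlg.gen_mul_gen h2 ha hs, Algebra.smul_def]
  rw [h, ← Algebra.commutes, ← Algebra.smul_def] at h1
  have := (hst r (-(d s s / 2)) (by rw [h1]; module)).1
  rw [h, this, map_zero]

/-- If `a t * a s = 0` with `a s`, `a t` independent, then `s` is isolated. -/
theorem SatisfiesSkewRel.eq_zero_of_mul_eq_zero (ha : SatisfiesSkewRel m d a) {s t : ι}
    (hst : ∀ u v : K, u • a s + v • a t = 0 → u = 0 ∧ v = 0) (h : a t * a s = 0) (k : ι) :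
    d s k = 0 := by
  -- Multiplying the relation for `s, k` by `a t` on the left reduces it to `(m s k * d t k) • a s =
  -- d s k • a t`.
  have h1 := congrArg (a t * ·) (ha s k)
  simp only [mul_add, ← mul_assoc, h, zero_mul, zero_add, mul_smul_comm] at h1
  rw [ha.mul_eq t k, sub_mul, smul_mul_assoc, smul_mul_assoc, mul_assoc, h, mul_zero, smul_zero,
    sub_zero, one_mul, ← Algebra.commutes, ← Algebra.smul_def] at h1
  simpa using (hst (m s k * d t k) (-d s k) (by rw [mul_smul, h1]; module)).2

end Consistency

namespace SkewAlg

/-! ### Reduction to pairwise independent generators. -/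

section Reduction

variable {K ι : Type*} [Field K] {m d : ι → ι → K}

/-- Not all generators of a nontrivial skew Clifford algebra vanish. -/
theorem exists_gen_ne_zero [Nonempty ι] [Nontrivial (SkewAlg m d)] : ∃ i, gen m d i ≠ 0 := by
  by_contra! h
  have hd (i j : ι) : d i j = 0 := by
    have := gen_satisfies m d i j
    rw [h, h, mul_zero, smul_zero, add_zero, eq_comm] at this
    exact (map_eq_zero _).1 this
  -- With `d = 0`, all generators may be sent to `ε`, which is nonzero and squares to zero.
  let f : SkewAlg m d →ₐ[K] DualNumber K := lift (fun _ => DualNumber.eps) fun i j => by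
    simp [hd]
  obtain ⟨i⟩ := ‹Nonempty ι›
  have := congrArg f (h i)
  simp only [f, lift_gen, map_zero] at this
  simpa using congrArg TrivSqZeroExt.snd this

/-- A nonzero generator which is a multiple of another one is not isolated. -/
theorem exists_ne_zero_of_gen_eq_smul (hd : ∀ i j, d i j = m i j * d j i) {i s : ι} (his : i ≠ s)
    {c : K} (h : gen m d i = c • gen m d s) (h0 : gen m d i ≠ 0) : ∃ k, d s k ≠ 0 := by
  classical
  by_contra! hs
  have hs' (k : ι) : d k s = 0 := by rw [hd, hs, mul_zero]
  -- As all `d s k` and `d k s` vanish, killing the generator `s` and fixing the others respects the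
  -- relations; this would kill the generator `i` too.
  let f : SkewAlg m d →ₐ[K] SkewAlg m d := lift (Function.update (gen m d) s 0) fun j k => by
    by_cases hj : j = s
    · subst hj; simp [hs]
    by_cases hk : k = s
    · subst hk; simp [hs']
    simpa [hj, hk] using gen_satisfies m d j k
  have := congrArg f h
  simp only [f, map_smul, lift_gen, Function.update_self, Function.update_of_ne his,
    smul_zero] at this
  exact h0 this

/-- If representatives of the nonzero generators up to proportionality are chosen, they generate
an isomorphic algebra. -/
theorem exists_algEquiv_of_representatives (h2 : (2 : K) ≠ 0) (hm' : ∀ i, m i i = 1)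
    (hd : ∀ i j, d i j = m i j * d j i) [Nontrivial (SkewAlg m d)] {τ : Type*} (r : τ → ι)
    (hr : ∀ s, gen m d (r s) ≠ 0) (hp : PairwiseLinearIndependent K (fun s => gen m d (r s)))
    (σ : ι → τ) (c : ι → K) (hσ : ∀ i, gen m d i = c i • gen m d (r (σ i))) :
    Nonempty (SkewAlg m d ≃ₐ[K] SkewAlg (fun s t => m (r s) (r t)) fun s t => d (r s) (r t)) := by
  set x := gen m d with hx
  set y := gen (fun s t => m (r s) (r t)) (fun s t => d (r s) (r t)) with hy
  have hX : SatisfiesSkewRel m d x := gen_satisfies m d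
  have hY : SatisfiesSkewRel (fun s t => m (r s) (r t)) (fun s t => d (r s) (r t)) y :=
    gen_satisfies _ _
  have inj : Function.Injective (algebraMap K (SkewAlg m d)) := (algebraMap K _).injective
  have rel : SatisfiesSkewRel m d (fun i => c i • y (σ i)) := by
    intro i j
    have hXij := hX i j
    rw [hσ i, hσ j] at hXij
    simp only [smul_mul_smul_comm] at hXij ⊢
    -- Within one class all products are scalars, so the relation is an identity in `K` and
    -- transfers.
    by_cases hst : σ i = σ j
    · rw [hst] at hXij ⊢
      rw [gen_mul_gen h2 hX (hm' _), Algebra.smul_def, Algebra.smul_def, Algebra.smul_def,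
        ← map_mul, ← map_mul, ← map_mul, ← map_add] at hXij
      rw [gen_mul_gen h2 hY (hm' _), Algebra.smul_def, Algebra.smul_def, Algebra.smul_def,
        ← map_mul, ← map_mul, ← map_mul, ← map_add, inj hXij]
    generalize hs : σ i = s at *
    generalize ht : σ j = t at *
    have ind := hp s t hst
    have ind' (u v : K) (h : u • x (r t) + v • x (r s) = 0) : u = 0 ∧ v = 0 :=
      hp t s (Ne.symm hst) u v h
    -- If this vanishes, the relation for `i, j` is `c i * c j` times that of the representatives.
    -- Otherwise their difference makes `x (r t) * x (r s)` a scalar, hence both products of the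
    -- representatives are zero and both are isolated in `d`. An isolated generator has no other
    -- nonzero multiple among the generators, so `i = r s` and `j = r t`, contradicting `hc`.
    by_cases hc : c i * c j * (m i j - m (r s) (r t)) = 0
    · have hc' : m i j * (c j * c i) = c i * c j * m (r s) (r t) := by linear_combination hc
      rw [smul_smul, hc', mul_smul (c i * c j), ← smul_add, hX, Algebra.smul_def, ← map_mul] at hXij
      rw [smul_smul, hc', mul_smul (c i * c j), ← smul_add, hY, Algebra.smul_def, ← map_mul, inj hXij]
    · exfalso
      have hci : c i ≠ 0 := fun h => hc (by rw [h]; ring)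
      have hcj : c j ≠ 0 := fun h => hc (by rw [h]; ring)
      have hts : x (r t) * x (r s) = algebraMap K _
          ((c i * c j * (m i j - m (r s) (r t)))⁻¹ * (d i j - c i * c j * d (r s) (r t))) := by
        rw [map_mul, ← Algebra.smul_def, eq_inv_smul_iff₀ hc, map_sub, ← hXij, map_mul,
          ← hX (r s) (r t), ← Algebra.smul_def]
        module
      have h0 := hX.mul_eq_zero_of_eq_algebraMap h2 (hm' _) ind' hts
      have hst' : x (r s) * x (r t) = algebraMap K _ (d (r s) (r t)) := by
        rw [← hX (r s) (r t), h0, smul_zero, add_zero]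
      have h0' := hX.mul_eq_zero_of_eq_algebraMap h2 (hm' _) ind hst'
      have iso (i : ι) (s : τ) (hi : x i = c i • x (r s)) (hci : c i ≠ 0)
          (hz : ∀ k, d (r s) k = 0) : i = r s := by
        by_contra his
        obtain ⟨k, hk⟩ := exists_ne_zero_of_gen_eq_smul hd his hi
          (by rw [← hx, hi]; exact smul_ne_zero hci (hr s))
        exact hk (hz k)
      have hi := iso i s (by rw [hσ i, hs]) hci (hX.eq_zero_of_mul_eq_zero ind h0)
      have hj := iso j t (by rw [hσ j, ht]) hcj (hX.eq_zero_of_mul_eq_zero ind' h0')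
      rw [← hi, ← hj, sub_self, mul_zero] at hc
      exact hc rfl
  refine ⟨AlgEquiv.ofAlgHom (lift _ rel) (lift (fun s => x (r s)) fun s t => hX (r s) (r t))
    (hom_ext fun s => ?_) (hom_ext fun i => ?_)⟩
  -- Nothing was assumed about `σ` and `c` on representatives; independence and nonvanishing force
  -- `σ (r s) = s` and `c (r s) = 1`.
  · have hs : σ (r s) = s := by
      by_contra h
      have := hp s (σ (r s)) (Ne.symm h) 1 (-c (r s)) (by
        rw [one_smul, neg_smul, ← hσ, add_neg_cancel])
      exact one_ne_zero this.1
    have hc : c (r s) = 1 := by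
      have := hσ (r s)
      rw [hs] at this
      by_contra h
      exact hr s ((smul_eq_zero.1 (show (1 - c (r s)) • x (r s) = 0 by
        rw [sub_smul, one_smul, ← this, sub_self])).resolve_left (sub_ne_zero.2 (Ne.symm h)))
    simp [hs, hc, hx, hy]
  · simpa [hx, hy] using (hσ i).symm

/-- Representatives of the nonzero generators up to proportionality exist. -/
theorem exists_representatives {A : Type*} [AddCommGroup A] [Module K A] {n : ℕ} (x : Fin n → A)
    (h0 : ∃ i, x i ≠ 0) :
    ∃ N, 1 ≤ N ∧ N ≤ n ∧ ∃ r : Fin N → Fin n, (∀ s, x (r s) ≠ 0) ∧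
      PairwiseLinearIndependent K (fun s => x (r s)) ∧ ∃ (σ : Fin n → Fin N) (c : Fin n → K),
        ∀ i, x i = c i • x (r (σ i)) := by
  classical
  let P (S : Finset (Fin n)) : Prop := (∀ s ∈ S, x s ≠ 0) ∧
    ∀ s ∈ S, ∀ t ∈ S, s ≠ t → ∀ c : K, x s ≠ c • x t
  -- By maximality, any nonzero `x i` outside `S` is proportional to a member of `S`.
  obtain ⟨S, hS⟩ := (Set.toFinite {S | P S}).exists_maximal ⟨∅, by simp [P]⟩
  have hP : P S := hS.prop
  have cover (i : Fin n) (hi : x i ≠ 0) : ∃ s ∈ S, ∃ c : K, x i = c • x s := by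
    by_contra! h
    have hiS : i ∉ S := fun hi => h i hi 1 (one_smul _ _).symm
    refine hiS (hS.le_of_ge (y := insert i S) ⟨?_, ?_⟩ (Finset.subset_insert i S)
      (Finset.mem_insert_self i S))
    · intro s hs
      rcases Finset.mem_insert.1 hs with rfl | hs
      exacts [hi, hP.1 s hs]
    · intro s hs t ht hst c
      rcases Finset.mem_insert.1 hs with rfl | hs' <;> rcases Finset.mem_insert.1 ht with rfl | ht'
      · exact absurd rfl hst
      · exact h t ht' c
      · intro hsi
        have hc : c ≠ 0 := fun hc => hP.1 s hs' (by rw [hsi, hc, zero_smul])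
        exact h s hs' c⁻¹ (by rw [hsi, inv_smul_smul₀ hc])
      · exact hP.2 s hs' t ht' hst c
  obtain ⟨i₀, hi₀⟩ := h0
  obtain ⟨s₀, hs₀, -⟩ := cover i₀ hi₀
  have cover' (i : Fin n) : ∃ s : Fin S.card, ∃ c : K, x i = c • x (S.orderEmbOfFin rfl s) := by
    suffices ∃ s ∈ S, ∃ c : K, x i = c • x s by
      obtain ⟨s, hs, c, hc⟩ := this
      obtain ⟨u, rfl⟩ : s ∈ Set.range (S.orderEmbOfFin rfl) := by
        rwa [Finset.range_orderEmbOfFin]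
      exact ⟨u, c, hc⟩
    by_cases hi : x i = 0
    -- A vanishing generator is attached to an arbitrary representative with coefficient 0.
    · exact ⟨s₀, hs₀, 0, by rw [hi, zero_smul]⟩
    · exact cover i hi
  choose σ c hσ using cover'
  refine ⟨S.card, Finset.card_pos.2 ⟨s₀, hs₀⟩, by simpa using S.card_le_univ,
    S.orderEmbOfFin rfl, fun s => hP.1 _ (S.orderEmbOfFin_mem rfl s), ?_, σ, c, hσ⟩
  intro s t hst u v huv
  have hne : S.orderEmbOfFin rfl s ≠ S.orderEmbOfFin rfl t :=
    fun h => hst ((S.orderEmbOfFin rfl).injective h)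
  have hs := S.orderEmbOfFin_mem rfl s
  have ht := S.orderEmbOfFin_mem rfl t
  have hu : u = 0 := by
    by_contra hu
    refine hP.2 _ hs _ ht hne (-(u⁻¹ * v)) ?_
    rw [neg_smul, mul_smul, ← smul_neg, eq_inv_smul_iff₀ hu]
    exact eq_neg_of_add_eq_zero_left huv
  refine ⟨hu, ?_⟩
  rw [hu, zero_smul, zero_add] at huv
  exact (smul_eq_zero.1 huv).resolve_right (hP.1 _ ht)

end Reduction

/-- The dimension of a nontrivial algebra `SkewAlg m d` is a power of two. -/
theorem exists_finrank_eq_two_pow {K : Type*} [Field K] (h2 : (2 : K) ≠ 0) {n : ℕ} (hn : 1 ≤ n)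
    {m d : Fin n → Fin n → K} (hm : ∀ i j, m i j * m j i = 1) (hm' : ∀ i, m i i = 1)
    (hd : ∀ i j, d i j = m i j * d j i) (hne : Nontrivial (SkewAlg m d)) :
    Module.Finite K (SkewAlg m d) ∧
      ∃ j : ℕ, 1 ≤ j ∧ j ≤ n ∧ Module.finrank K (SkewAlg m d) = 2 ^ j := by
  have : Nonempty (Fin n) := ⟨⟨0, hn⟩⟩
  obtain ⟨N, hN, hNn, r, hr, hp, σ, c, hσ⟩ :=
    exists_representatives (K := K) (gen m d) exists_gen_ne_zero
  obtain ⟨e⟩ := exists_algEquiv_of_representatives h2 hm' hd r hr hp σ c hσ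
  have hX : SatisfiesSkewRel (fun s t => m (r s) (r t)) (fun s t => d (r s) (r t))
      (fun s => gen m d (r s)) := fun s t => gen_satisfies m d (r s) (r t)
  obtain ⟨h3, h4⟩ := finite_and_finrank h2 (hX.consistent h2 (fun _ _ => hm _ _)
    (fun _ => hm' _) (fun _ _ => hd _ _) hp)
  exact ⟨Module.Finite.equiv e.symm.toLinearEquiv, N, hN, hNn,
    by rw [e.toLinearEquiv.finrank_eq, h4]⟩

end SkewAlg

/-! ### Identification of the skew Clifford algebra with the presented algebra. -/

namespace SkewCliffordAlgebra

variable {K V : Type*} [Field K] [AddCommGroup V] [Module K V] {n : ℕ}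
  (x : Module.Basis (Fin n) K V) (μ : Matrix (Fin n) (Fin n) K) (φ : LinearMap.BilinForm K V)

/-- The quotient map from the tensor algebra. -/
def mk : TensorAlgebra K V →ₐ[K] SkewCliffordAlgebra x μ φ :=
  RingQuot.mkAlgHom K (SkewCliffordRel x μ φ)

theorem mk_rel : SatisfiesSkewRel (fun i j => μ i j) (fun i j => 2 * φ (x i) (x j))
    (fun i => mk x μ φ (TensorAlgebra.ι K (x i))) := by
  intro i j
  have h : mk x μ φ _ = mk x μ φ _ := RingQuot.mkAlgHom_rel K (SkewCliffordRel.of i j)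
  rw [map_sub, map_add, map_smul, map_mul, map_mul, AlgHom.commutes, map_zero, sub_eq_zero] at h
  exact h

theorem hom_ext {A : Type*} [Ring A] [Algebra K A] {f g : SkewCliffordAlgebra x μ φ →ₐ[K] A}
    (h : ∀ i, f (mk x μ φ (TensorAlgebra.ι K (x i))) = g (mk x μ φ (TensorAlgebra.ι K (x i)))) :
    f = g := by
  have h1 : f.comp (mk x μ φ) = g.comp (mk x μ φ) := TensorAlgebra.hom_ext (x.ext h)
  refine AlgHom.ext fun a => ?_
  obtain ⟨a, rfl⟩ : ∃ b, mk x μ φ b = a := RingQuot.mkAlgHom_surjective K _ a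
  exact congr($h1 a)

/-- The presentation of the skew Clifford algebra by the basis elements. -/
noncomputable def equivSkewAlg :
    SkewCliffordAlgebra x μ φ ≃ₐ[K] SkewAlg (fun i j => μ i j) fun i j => 2 * φ (x i) (x j) :=
  let f : SkewCliffordAlgebra x μ φ →ₐ[K] SkewAlg (fun i j => μ i j) fun i j => 2 * φ (x i) (x j) :=
    RingQuot.liftAlgHom K ⟨TensorAlgebra.lift K (x.constr K (SkewAlg.gen _ _)), by
      rintro _ _ ⟨i, j⟩
      have := SkewAlg.gen_satisfies (fun i j => μ i j) (fun i j => 2 * φ (x i) (x j)) i j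
      rw [map_sub, map_add, map_smul, map_mul, map_mul, AlgHom.commutes, map_zero, sub_eq_zero]
      simpa only [TensorAlgebra.lift_ι_apply, Module.Basis.constr_basis] using this⟩
  have hf (i : Fin n) : f (mk x μ φ (TensorAlgebra.ι K (x i))) = SkewAlg.gen _ _ i :=
    (RingQuot.liftAlgHom_mkAlgHom_apply K _ _ _).trans (by simp)
  AlgEquiv.ofAlgHom f (SkewAlg.lift _ (mk_rel x μ φ))
    (SkewAlg.hom_ext fun i => by simp [hf]) (hom_ext x μ φ fun i => by simp [hf])

end SkewCliffordAlgebra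

theorem mainTheorem3 {K V : Type*} [Field K] [AddCommGroup V] [Module K V]
    (hchar : ringChar K ≠ 2) {n : ℕ} (hn : 1 ≤ n)
    (x : Module.Basis (Fin n) K V) (μ : Matrix (Fin n) (Fin n) K) (hμ : IsMultAntisymm μ)
    (φ : LinearMap.BilinForm K V) (hφ : IsMuSymm x μ φ)
    (hne : Nontrivial (SkewCliffordAlgebra x μ φ)) :
    Module.Finite K (SkewCliffordAlgebra x μ φ) ∧
      ∃ j : ℕ, 1 ≤ j ∧ j ≤ Module.finrank K V ∧
        Module.finrank K (SkewCliffordAlgebra x μ φ) = 2 ^ j := by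
  let e := SkewCliffordAlgebra.equivSkewAlg x μ φ
  obtain ⟨h1, j, h2, h3, h4⟩ := SkewAlg.exists_finrank_eq_two_pow
    (Ring.two_ne_zero hchar) hn (m := fun i j => μ i j) (d := fun i j => 2 * φ (x i) (x j))
    (fun i j => (hμ i j).1) (fun i => (hμ i i).2) (fun i j => by
      rw [hφ i j]; ring) e.injective.nontrivial
  refine ⟨Module.Finite.equiv e.symm.toLinearEquiv, j, h2, ?_, ?_⟩
  · rwa [Module.finrank_eq_card_basis x, Fintype.card_fin]
  · rw [e.toLinearEquiv.finrank_eq, h4]
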